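/- **Setting.** Let $S$ be a measurable space whose diagonal is measurable in $S\times S$, and let $P$ be a Markov kernel on $S$ with $n$-step transition probabilities $\mathsf P_x(n,\cdot)=\mu^x_n$. For $m\ge 1$ and $x^1,x^2\in S$ put $$\alpha^{(m)}(x^1,x^2)=\int\Big(\frac{\mathsf P_{x^2}(m,dy)}{\mathsf P_{x^1}(m,dy)}\wedge 1\Big)\mathsf P_{x^1}(m,dy),$$ where the quotient is the density of the absolutely continuous part. Let $p^i$ be the density of $\mathsf P_{x^i}(m,\cdot)$ with respect to $\Lambda=\mathsf P_{x^1}(m,\cdot)+\mathsf P_{x^2}(m,\cdot)$. If $\alpha^{(m)}(x^1,x^2)<1$, let $\eta^1,\eta^2$ be independent with $\Lambda$-densities $$\frac{p^1-p^1\wedge p^2}{1-\alpha^{(m)}(x^1,x^2)},\qquad \frac{p^2-p^1\wedge p^2}{1-\alpha^{(m)}(x^1,x^2)};$$ if $\alpha^{(m)}(x^1,x^2)=1$, let both have law $\mathsf P_{x^1}(m,\cdot)$. (In the $m$-step Markovian coupling the two copies coincide after $m$ steps with probability $\alpha^{(m)}(x^1,x^2)$, and otherwise they move to $(\eta^1,\eta^2)$.)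 Assume that, for every $m$, the measure $(1-\alpha^{(m)}(x))\,\mathcal L(\eta^1)\otimes\mathcal L(\eta^2)$ depends measurably on $x=(x^1,x^2)$; this is automatic if the $\sigma$-algebra of $S$ is countably generated. Define $$V^{(m)}h(x)=(1-\alpha^{(m)}(x))\,\mathsf E_{x}h(\eta^1,\eta^2)$$ on bounded measurable functions on $S\times S$ with the supremum norm. Let $\hat V^{(m)}$ be given by the same formula on bounded measurable functions on $\{(x^1,x^2):x^1\ne x^2\}$, the function $h$ being set equal to $0$ on the diagonal. Let $r(\cdot)$ be the spectral radius (on complex-valued functions), let $\|\cdot\|_{TV}$ be the total variation norm, and let $\ln 0=-\infty$. **Theorem.** 1. Let $\mu$ be an invariant probability measure of $P$. For every $x^1\in S$ and every $m\ge1$, $$\limsup_{n\to\infty}\frac1n\ln\|\mathsf P_{x^1}(n,\cdot)-\mu\|_{TV}\ \le\ \limsup_{n\to\infty}\frac1{nm}\ln\int 2\,(V^{(m)})^n\mathbf 1(x^1,x^2)\,\mu(dx^2)\ \le\ \frac1m\ln r(V^{(m)})=\frac1m\ln r(\hat V^{(m)}).$$ 2. Let $\lambda>0$ be such that for every $\varepsilon>0$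 there are $C>0$ and $m_0$ with $$\sup_{x,x'}\|\mu^x_m-\mu^{x'}_m\|_{TV}\le C(\lambda+\varepsilon)^m\qquad\text{for all } m\ge m_0 .$$ Then for every $\varepsilon>0$ there is $m_1$ such that for all $m\ge m_1$ $$r(\hat V^{(m)})\le(\lambda+\varepsilon)^m\quad\text{and}\quad r(\hat V^{(m)})\le\lambda+\varepsilon .$$ -/

import Mathlib

open MeasureTheory ProbabilityTheory Filter Set
open scoped ENNReal Topology

noncomputable section

/-! ### Bounded measurable functions and sub-Markov operators -/

section Operators

variable (𝕜 : Type*) [RCLike 𝕜] [MeasurableSpace 𝕜] [BorelSpace 𝕜]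
variable {X : Type*} [MeasurableSpace X]

variable (X) in
/-- The space of bounded measurable functions `X → 𝕜` with the supremum norm. -/
def BoundedMeasurable : Submodule 𝕜 (lp (fun _ : X => 𝕜) ∞) where
  carrier := {f | Measurable (f : X → 𝕜)}
  add_mem' hf hg := by
    simp only [mem_ofPred_eq, lp.coeFn_add] at *
    exact hf.add hg
  zero_mem' := by
    simp only [mem_ofPred_eq, lp.coeFn_zero]
    exact measurable_const
  smul_mem' c f hf := by
    simp only [mem_ofPred_eq, lp.coeFn_smul] at *
    exact hf.const_smul c

namespace BoundedMeasurable

variable {𝕜}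

/-- A bounded measurable function as an element of the space. -/
def mk (f : X → 𝕜) (hf : Measurable f) (C : ℝ) (hC : ∀ x, ‖f x‖ ≤ C) : BoundedMeasurable 𝕜 X :=
  ⟨⟨f, memℓp_infty ⟨C, by rintro _ ⟨x, rfl⟩; exact hC x⟩⟩, hf⟩

/-- The underlying function. -/
instance : CoeFun (BoundedMeasurable 𝕜 X) fun _ => X → 𝕜 :=
  ⟨fun f => ((f : lp (fun _ : X => 𝕜) ∞) : X → 𝕜)⟩

variable (𝕜 X) in
/-- The constant function `1`. -/
def one : BoundedMeasurable 𝕜 X := mk (fun _ => 1) measurable_const 1 (fun _ => by simp)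

theorem norm_apply_le (f : BoundedMeasurable 𝕜 X) (x : X) : ‖f x‖ ≤ ‖f‖ :=
  lp.norm_apply_le_norm ENNReal.top_ne_zero (f : lp (fun _ : X => 𝕜) ∞) x

theorem integrable (f : BoundedMeasurable 𝕜 X) (ρ : Measure X) [IsFiniteMeasure ρ] :
    Integrable (f : X → 𝕜) ρ :=
  Integrable.of_bound f.2.aestronglyMeasurable ‖f‖ (Eventually.of_forall (norm_apply_le f))

theorem norm_integral_le (Q : Kernel X X) (hQ : ∀ x, Q x univ ≤ 1)
    (f : BoundedMeasurable 𝕜 X) (x : X) : ‖∫ y, f y ∂(Q x)‖ ≤ ‖f‖ := by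
  have : IsFiniteMeasure (Q x) := ⟨(hQ x).trans_lt ENNReal.one_lt_top⟩
  refine (norm_integral_le_of_norm_le_const (C := ‖f‖)
    (Eventually.of_forall (norm_apply_le f))).trans ?_
  have h1 : (Q x).real univ ≤ 1 := ENNReal.toReal_le_of_le_ofReal zero_le_one (by simpa using hQ x)
  exact mul_le_of_le_one_right (norm_nonneg _) h1

end BoundedMeasurable

/-- The operator `f ↦ (x ↦ ∫ f(y) Q(x, dy))` of a sub-Markov kernel `Q`, acting on bounded
measurable functions. -/
def kernelOp (Q : Kernel X X) (hQ : ∀ x, Q x univ ≤ 1) :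
    BoundedMeasurable 𝕜 X →L[𝕜] BoundedMeasurable 𝕜 X :=
  LinearMap.mkContinuous
    { toFun := fun f => BoundedMeasurable.mk (fun x => ∫ y, f y ∂(Q x))
        (by
          have : IsFiniteKernel Q := ⟨1, ENNReal.one_lt_top, hQ⟩
          have h : StronglyMeasurable (f : X → 𝕜) := Measurable.stronglyMeasurable f.2
          exact (StronglyMeasurable.integral_kernel h).measurable)
        ‖f‖ (BoundedMeasurable.norm_integral_le Q hQ f)
      map_add' := fun f g => by
        ext x
        have : IsFiniteMeasure (Q x) := ⟨(hQ x).trans_lt ENNReal.one_lt_top⟩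
        exact integral_add (BoundedMeasurable.integrable f (Q x)) (BoundedMeasurable.integrable g (Q x))
      map_smul' := fun c f => by
        ext x
        exact integral_smul c (f : X → 𝕜) }
    1 (fun f => by
      rw [one_mul]
      exact lp.norm_le_of_forall_le (norm_nonneg _) (BoundedMeasurable.norm_integral_le Q hQ f))

theorem kernelOp_apply (Q : Kernel X X) (hQ : ∀ x, Q x univ ≤ 1)
    (f : BoundedMeasurable 𝕜 X) (x : X) : kernelOp 𝕜 Q hQ f x = ∫ y, f y ∂(Q x) := rfl

end Operators

/-! ### Total variation, the `m`-step coupling and the operators `V`, `V̂` -/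

section Coupling

variable {S : Type*} [MeasurableSpace S]

/-- The total variation norm `‖ρ - ν‖_TV` of the difference of two finite measures. -/
def tvNorm (ρ ν : Measure S) [IsFiniteMeasure ρ] [IsFiniteMeasure ν] : ℝ≥0∞ :=
  (ρ.toSignedMeasure - ν.toSignedMeasure).totalVariation univ

/-- The `n`-step transition probabilities of a Markov chain are probability measures. -/
instance isMarkovKernel_npow (P : Kernel S S) [IsMarkovKernel P] (n : ℕ) :
    IsMarkovKernel (P ^ n) := by
  induction n with
  | zero => rw [pow_zero]; exact inferInstanceAs (IsMarkovKernel Kernel.id)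
  | succ n ih => rw [pow_succ]; exact inferInstanceAs (IsMarkovKernel ((P ^ n) ∘ₖ P))

/-- `α⁽ᵐ⁾(x, x') = ∫ (P_{x'}(m, dy) / P_x(m, dy) ∧ 1) P_x(m, dy)`, the quotient being the density of
the absolutely continuous part. -/
def overlap (P : Kernel S S) (m : ℕ) (x x' : S) : ℝ≥0∞ :=
  ∫⁻ y, min (((P ^ m) x').rnDeriv ((P ^ m) x) y) 1 ∂((P ^ m) x)

/-- The measure with density `p⁽ᵐ⁾(x, ·) - p⁽ᵐ⁾(x, ·) ∧ p⁽ᵐ⁾(x', ·)` with respect to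
`Λ = P_x(m, ·) + P_{x'}(m, ·)`, where `p⁽ᵐ⁾` are the densities with respect to `Λ`. -/
def excess (P : Kernel S S) (m : ℕ) (x x' : S) : Measure S :=
  ((P ^ m) x + (P ^ m) x').withDensity fun y =>
    ((P ^ m) x).rnDeriv ((P ^ m) x + (P ^ m) x') y -
      min (((P ^ m) x).rnDeriv ((P ^ m) x + (P ^ m) x') y)
        (((P ^ m) x').rnDeriv ((P ^ m) x + (P ^ m) x') y)

open Classical in
/-- The law of the component `η¹` of the `m`-step coupling started from the not yet coupled
states `x = (x¹, x²)`: density `(p¹ - p¹ ∧ p²) / (1 - α⁽ᵐ⁾(x¹, x²))`, and `P_{x¹}(m, ·)` in the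
degenerate case `α⁽ᵐ⁾(x¹, x²) = 1`. -/
def etaLaw₁ (P : Kernel S S) (m : ℕ) (x : S × S) : Measure S :=
  if overlap P m x.1 x.2 = 1 then (P ^ m) x.1
  else (1 - overlap P m x.1 x.2)⁻¹ • excess P m x.1 x.2

open Classical in
/-- The law of the component `η²`: density `(p² - p¹ ∧ p²) / (1 - α⁽ᵐ⁾(x¹, x²))`, and
`P_{x¹}(m, ·)` in the degenerate case. -/
def etaLaw₂ (P : Kernel S S) (m : ℕ) (x : S × S) : Measure S :=
  if overlap P m x.1 x.2 = 1 then (P ^ m) x.1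
  else (1 - overlap P m x.1 x.2)⁻¹ • excess P m x.2 x.1

/-- The sub-probability measure
`A ↦ P_x(no coupling during the m-step transition, (η¹, η²) ∈ A)`: with probability
`1 - α⁽ᵐ⁾(x)` the two copies are not coupled, and then they move independently according to the
laws of `η¹` and `η²`. -/
def uncoupledLaw (P : Kernel S S) (m : ℕ) (x : S × S) : Measure (S × S) :=
  (1 - overlap P m x.1 x.2) • (etaLaw₁ P m x).prod (etaLaw₂ P m x)

/-- The coupling depends measurably on the pair of current states. -/
def MeasurableCoupling (P : Kernel S S) : Prop := ∀ m, Measurable (uncoupledLaw P m)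

section Mass

theorem lintegral_min_rnDeriv (μ ν : Measure S) [IsProbabilityMeasure μ] [IsProbabilityMeasure ν] :
    ∫⁻ y, min (μ.rnDeriv (μ + ν) y) (ν.rnDeriv (μ + ν) y) ∂(μ + ν) =
      ∫⁻ y, min (ν.rnDeriv μ y) 1 ∂μ := by
  have hμ : μ ≪ μ + ν := Measure.absolutelyContinuous_of_le (Measure.le_add_right le_rfl)
  have h1 : ∫⁻ y, min (ν.rnDeriv μ y) 1 ∂μ =
      ∫⁻ y, min (ν.rnDeriv (μ + ν) y / μ.rnDeriv (μ + ν) y) 1 ∂μ := by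
    refine lintegral_congr_ae ?_
    filter_upwards [ν.rnDeriv_eq_div_rnDeriv_add μ] with y hy
    rw [hy, add_comm ν μ]
  rw [h1, ← lintegral_rnDeriv_mul hμ (by fun_prop)]
  refine lintegral_congr_ae ?_
  filter_upwards [μ.rnDeriv_lt_top (μ + ν)] with y hy
  rcases eq_or_ne (μ.rnDeriv (μ + ν) y) 0 with h0 | h0
  · simp [h0]
  · rw [mul_min, mul_one, ENNReal.mul_div_cancel h0 hy.ne, min_comm]

theorem excess_univ (P : Kernel S S) [IsMarkovKernel P] (m : ℕ) (x x' : S) :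
    excess P m x x' univ = 1 - overlap P m x x' := by
  have hμ : (P ^ m) x ≪ (P ^ m) x + (P ^ m) x' :=
    Measure.absolutelyContinuous_of_le (Measure.le_add_right le_rfl)
  rw [excess, withDensity_apply _ MeasurableSet.univ, Measure.restrict_univ, lintegral_sub,
    Measure.lintegral_rnDeriv hμ, measure_univ, lintegral_min_rnDeriv, overlap]
  · fun_prop
  · rw [lintegral_min_rnDeriv]
    refine ne_top_of_le_ne_top ENNReal.one_ne_top
      ((lintegral_mono fun y => min_le_right _ _).trans ?_)
    simp
  · exact Eventually.of_forall fun y => min_le_left _ _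

theorem overlap_comm (P : Kernel S S) [IsMarkovKernel P] (m : ℕ) (x x' : S) :
    overlap P m x x' = overlap P m x' x := by
  rw [overlap, overlap, ← lintegral_min_rnDeriv, ← lintegral_min_rnDeriv, add_comm ((P ^ m) x)]
  simp_rw [min_comm]

theorem overlap_le_one (P : Kernel S S) [IsMarkovKernel P] (m : ℕ) (x x' : S) :
    overlap P m x x' ≤ 1 :=
  (lintegral_mono fun y => min_le_right _ _).trans (by simp)

theorem excess_univ_le (P : Kernel S S) [IsMarkovKernel P] (m : ℕ) (x x' : S) :
    excess P m x x' univ ≤ 1 := by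
  rw [excess_univ]; exact tsub_le_self

instance (P : Kernel S S) [IsMarkovKernel P] (m : ℕ) (x x' : S) :
    IsFiniteMeasure (excess P m x x') :=
  ⟨(excess_univ_le P m x x').trans_lt ENNReal.one_lt_top⟩

instance (P : Kernel S S) [IsMarkovKernel P] (m : ℕ) (x : S × S) :
    IsProbabilityMeasure (etaLaw₁ P m x) := by
  unfold etaLaw₁
  split_ifs with h
  · infer_instance
  · have h1 : 1 - overlap P m x.1 x.2 ≠ 0 := by
      rw [Ne, tsub_eq_zero_iff_le]; exact fun h2 => h (le_antisymm (overlap_le_one ..) h2)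
    exact ⟨by rw [Measure.smul_apply, smul_eq_mul, excess_univ,
      ENNReal.inv_mul_cancel h1 (by finiteness)]⟩

instance (P : Kernel S S) [IsMarkovKernel P] (m : ℕ) (x : S × S) :
    IsProbabilityMeasure (etaLaw₂ P m x) := by
  unfold etaLaw₂
  split_ifs with h
  · infer_instance
  · have h1 : 1 - overlap P m x.1 x.2 ≠ 0 := by
      rw [Ne, tsub_eq_zero_iff_le]; exact fun h2 => h (le_antisymm (overlap_le_one ..) h2)
    exact ⟨by rw [Measure.smul_apply, smul_eq_mul, excess_univ, overlap_comm P m x.2,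
      ENNReal.inv_mul_cancel h1 (by finiteness)]⟩

theorem uncoupledLaw_univ_le (P : Kernel S S) [IsMarkovKernel P] (m : ℕ) (x : S × S) :
    uncoupledLaw P m x univ ≤ 1 := by
  simp [uncoupledLaw]

theorem uncoupledLaw_eq (P : Kernel S S) [IsMarkovKernel P] (m : ℕ) (x : S × S) :
    uncoupledLaw P m x =
      (1 - overlap P m x.1 x.2)⁻¹ • (excess P m x.1 x.2).prod (excess P m x.2 x.1) := by
  by_cases h : overlap P m x.1 x.2 = 1
  · have h0 : excess P m x.1 x.2 = 0 := by
      rw [← Measure.measure_univ_eq_zero, excess_univ, h, tsub_self]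
    simp [uncoupledLaw, h, h0]
  · have h1 : 1 - overlap P m x.1 x.2 ≠ 0 := by
      rw [Ne, tsub_eq_zero_iff_le]; exact fun h2 => h (le_antisymm (overlap_le_one ..) h2)
    have h2 : 1 - overlap P m x.1 x.2 ≠ ∞ := by finiteness
    rw [uncoupledLaw, etaLaw₁, etaLaw₂, if_neg h, if_neg h, Measure.prod_smul_left,
      Measure.prod_smul_right, smul_smul, smul_smul, ENNReal.mul_inv_cancel h1 h2, one_mul]

/-- On a countably generated state space the measurability of the coupling is automatic. -/
theorem measurableCoupling_of_countablyGenerated [MeasurableSpace.CountablyGenerated S]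
    (P : Kernel S S) [IsMarkovKernel P] : MeasurableCoupling P := by
  intro m
  let κ₁ : Kernel (S × S) S := (P ^ m).comap Prod.fst measurable_fst
  let κ₂ : Kernel (S × S) S := (P ^ m).comap Prod.snd measurable_snd
  have key : ∀ κ κ' : Kernel (S × S) S, IsFiniteKernel κ → IsFiniteKernel κ' →
      ∃ ρ : Kernel (S × S) S, ∀ x, ρ x = (κ x + κ' x).withDensity fun y =>
        (κ x).rnDeriv (κ x + κ' x) y -
          min ((κ x).rnDeriv (κ x + κ' x) y) ((κ' x).rnDeriv (κ x + κ' x) y) := by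
    intro κ κ' _ _
    refine ⟨Kernel.withDensity (κ + κ') fun x y => Kernel.rnDeriv κ (κ + κ') x y -
      min (Kernel.rnDeriv κ (κ + κ') x y) (Kernel.rnDeriv κ' (κ + κ') x y), fun x => ?_⟩
    rw [Kernel.withDensity_apply]
    · refine withDensity_congr_ae ?_
      filter_upwards [Kernel.rnDeriv_eq_rnDeriv_measure (κ := κ) (η := κ + κ') (a := x),
        Kernel.rnDeriv_eq_rnDeriv_measure (κ := κ') (η := κ + κ') (a := x)] with y h1 h2
      rw [h1, h2]
      rfl
    · have h1 := Kernel.measurable_rnDeriv κ (κ + κ')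
      have h2 := Kernel.measurable_rnDeriv κ' (κ + κ')
      exact h1.sub (h1.min h2)
  obtain ⟨ρ₁, h₁⟩ := key κ₁ κ₂ inferInstance inferInstance
  obtain ⟨ρ₂, h₂⟩ := key κ₂ κ₁ inferInstance inferInstance
  replace h₁ : ∀ x, ρ₁ x = excess P m x.1 x.2 := h₁
  replace h₂ : ∀ x, ρ₂ x = excess P m x.2 x.1 := h₂
  have : IsFiniteKernel ρ₁ := ⟨1, ENNReal.one_lt_top, fun x => by rw [h₁]; exact excess_univ_le ..⟩
  have : IsFiniteKernel ρ₂ := ⟨1, ENNReal.one_lt_top, fun x => by rw [h₂]; exact excess_univ_le ..⟩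
  refine Measure.measurable_of_measurable_coe _ fun s hs => ?_
  have h : ∀ x, uncoupledLaw P m x s = (ρ₁ x univ)⁻¹ * (ρ₁ ×ₖ ρ₂) x s := fun x => by
    rw [uncoupledLaw_eq, Measure.smul_apply, smul_eq_mul, Kernel.prod_apply, h₁, h₂, excess_univ]
  simp_rw [h]
  exact (Kernel.measurable_coe ρ₁ MeasurableSet.univ).inv.mul (Kernel.measurable_coe _ hs)

end Mass

/-- `uncoupledLaw` as a kernel on `S × S`. -/
def uncoupledKernel (P : Kernel S S) (hP : MeasurableCoupling P) (m : ℕ) :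
    Kernel (S × S) (S × S) where
  toFun := uncoupledLaw P m
  measurable' := hP m

variable (S) in
/-- `S × S` without its diagonal. -/
abbrev OffDiag : Type _ := {x : S × S // x.1 ≠ x.2}

theorem measurableEmbedding_offDiag [MeasurableEq S] :
    MeasurableEmbedding (Subtype.val : OffDiag S → S × S) :=
  MeasurableEmbedding.subtype_coe
    (measurableSet_eq_fun (measurable_fst (α := S) (β := S)) measurable_snd).compl

/-- The part of `uncoupledKernel` that lives off the diagonal. -/
def uncoupledKernelHat [MeasurableEq S] (P : Kernel S S) (hP : MeasurableCoupling P) (m : ℕ) :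
    Kernel (OffDiag S) (OffDiag S) :=
  ((uncoupledKernel P hP m).comap Subtype.val measurable_subtype_coe).comapRight
    measurableEmbedding_offDiag

theorem uncoupledKernelHat_univ_le [MeasurableEq S] (P : Kernel S S) [IsMarkovKernel P]
    (hP : MeasurableCoupling P) (m : ℕ) (x : OffDiag S) :
    uncoupledKernelHat P hP m x univ ≤ 1 := by
  rw [uncoupledKernelHat, Kernel.comapRight_apply' _ _ _ MeasurableSet.univ]
  exact (measure_mono (subset_univ _)).trans (uncoupledLaw_univ_le P m x)

variable (𝕜 : Type*) [RCLike 𝕜] [MeasurableSpace 𝕜] [BorelSpace 𝕜]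

/-- The operator `V⁽ᵐ⁾ h (x) = (1 - α⁽ᵐ⁾(x)) E_x h(η¹, η²)` on bounded measurable functions on
`S × S`; see `opV_apply`. -/
def opV (P : Kernel S S) [IsMarkovKernel P] (hP : MeasurableCoupling P) (m : ℕ) :
    BoundedMeasurable 𝕜 (S × S) →L[𝕜] BoundedMeasurable 𝕜 (S × S) :=
  kernelOp 𝕜 (uncoupledKernel P hP m) (uncoupledLaw_univ_le P m)

/-- The operator `V̂⁽ᵐ⁾` on bounded measurable functions on `S × S` without the diagonal;
see `opVhat_apply`. -/
def opVhat [MeasurableEq S] (P : Kernel S S) [IsMarkovKernel P] (hP : MeasurableCoupling P) (m : ℕ) :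
    BoundedMeasurable 𝕜 (OffDiag S) →L[𝕜] BoundedMeasurable 𝕜 (OffDiag S) :=
  kernelOp 𝕜 (uncoupledKernelHat P hP m) (uncoupledKernelHat_univ_le P hP m)

theorem opV_apply (P : Kernel S S) [IsMarkovKernel P] (hP : MeasurableCoupling P) (m : ℕ)
    (h : BoundedMeasurable 𝕜 (S × S)) (x : S × S) :
    opV 𝕜 P hP m h x = (1 - overlap P m x.1 x.2).toReal •
      ∫ y, h y ∂((etaLaw₁ P m x).prod (etaLaw₂ P m x)) :=
  integral_smul_measure _ _

open Classical in
theorem opVhat_apply [MeasurableEq S] (P : Kernel S S) [IsMarkovKernel P]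
    (hP : MeasurableCoupling P) (m : ℕ) (h : BoundedMeasurable 𝕜 (OffDiag S)) (x : OffDiag S) :
    opVhat 𝕜 P hP m h x = (1 - overlap P m x.1.1 x.1.2).toReal •
      ∫ y, (if hy : y.1 ≠ y.2 then h ⟨y, hy⟩ else 0)
        ∂((etaLaw₁ P m x).prod (etaLaw₂ P m x)) := by
  rw [← integral_smul_measure]
  change ∫ y, h y ∂((uncoupledLaw P m x).comap Subtype.val) = ∫ y, _ ∂(uncoupledLaw P m x)
  have hr : range (Subtype.val : OffDiag S → S × S) = {y : S × S | y.1 ≠ y.2} := Subtype.range_val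
  set g : S × S → 𝕜 := fun y => if hy : y.1 ≠ y.2 then h ⟨y, hy⟩ else 0 with hg
  have h1 : ∀ y : OffDiag S, h y = g y.1 := fun y => by simp only [hg]; rw [dif_pos y.2]
  simp_rw [h1]
  rw [← measurableEmbedding_offDiag.integral_map, measurableEmbedding_offDiag.map_comap, hr]
  refine setIntegral_eq_integral_of_forall_compl_eq_zero fun y hy => ?_
  simp only [hg]
  exact dif_neg hy

end Coupling

end

/-! ### Exponential bounds versus logarithmic growth rates. -/

section Limits

/-! Split each `m`-step law into the common part of the pair and an excess. The common parts cancel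
in a difference of expectations, so `V` carries `f x - f x'` to the same expression for the `m`-step
average of `f` (`opV_pairDiff`). Iterating this, with `f` the `j`-step probability of a set `A`, and
using positivity of `V` together with `f x - f x' ≤ 1`, bounds the difference of the `(k m +
j)`-step probabilities of `A` by `V^k 1 (x, x')`. Integrating over `x'` against the invariant `μ`
gives `tvNorm_pow_le`; with `j` the remainder of `n` mod `m` this is the first inequality. The
second follows from `V^n 1 ≤ ‖V^n 1‖` and Gelfand's formula.

The two excess measures are mutually singular, so the uncoupled law never charges the diagonal, and
it vanishes when started there. Hence `V` is `V̂` preceded by restriction and followed by extension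
by zero; powers have equal norms, and so do the spectral radii (`spectralRadius_opV_eq`).

For the second claim, the mass `1 - α` of the uncoupled law is at most the total variation distance
of the `m`-step laws, so the assumed decay bounds `‖V̂‖`, hence `r(V̂)`. -/

theorem limsup_log_div_le_of_eventually_le {u : ℕ → ℝ≥0∞} {d : ℕ → ℕ} (hd : Tendsto d atTop atTop)
    {K c : ℝ} (hK : 0 < K) (h : ∀ᶠ n in atTop, u n ≤ ENNReal.ofReal (K * Real.exp (c * d n))) :
    limsup (fun n => ENNReal.log (u n) / (d n : EReal)) atTop ≤ (c : EReal) := by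
  have hlim : Tendsto (fun n => ((c + Real.log K / d n : ℝ) : EReal)) atTop (𝓝 (c : EReal)) := by
    refine (continuous_coe_real_ereal.tendsto c).comp ?_
    have h1 : Tendsto (fun n => Real.log K / (d n : ℝ)) atTop (𝓝 0) :=
      (tendsto_natCast_atTop_atTop.comp hd).const_div_atTop _
    simpa using h1.const_add c
  refine (limsup_le_limsup ?_).trans hlim.limsup_eq.le
  filter_upwards [h, hd.eventually_ge_atTop 1] with n hn hdn
  have hpos : (0 : ℝ) < d n := by exact_mod_cast hdn
  have hd0 : (0 : EReal) < (d n : EReal) := by exact_mod_cast hdn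
  rw [EReal.div_le_iff_le_mul hd0 (EReal.natCast_ne_top _)]
  refine (ENNReal.log_le_log hn).trans ?_
  rw [ENNReal.log_ofReal_of_pos (by positivity), Real.log_mul hK.ne' (Real.exp_ne_zero _),
    Real.log_exp]
  have h2 : ((d n : ℕ) : EReal) = ((d n : ℝ) : EReal) := rfl
  rw [h2, ← EReal.coe_mul, EReal.coe_le_coe_iff]
  field_simp
  linarith

theorem le_ofReal_exp_of_log_div_le {u : ℝ≥0∞} {d : ℕ} (hd : 1 ≤ d) {c : ℝ}
    (h : ENNReal.log u / (d : EReal) ≤ (c : EReal)) : u ≤ ENNReal.ofReal (Real.exp (c * d)) := by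
  have hd0 : (0 : EReal) < (d : EReal) := by exact_mod_cast hd
  rw [EReal.div_le_iff_le_mul hd0 (EReal.natCast_ne_top _)] at h
  rw [← ENNReal.log_le_log_iff, ENNReal.log_ofReal_of_pos (Real.exp_pos _), Real.log_exp]
  rw [mul_comm c, EReal.coe_mul]
  exact h

end Limits

/-! ### Total variation tested on measurable sets. -/

section TotalVariation

variable {S : Type*} [MeasurableSpace S]

/-- Both masses being one, the positive and negative variations are equal; each is a difference on a
single Hahn set, which gives the factor 2. -/
theorem tvNorm_le_of_forall_real_sub_le (ρ ν : Measure S) [IsProbabilityMeasure ρ]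
    [IsProbabilityMeasure ν] {a : ℝ}
    (h : ∀ A, MeasurableSet A → ρ.real A - ν.real A ≤ a) :
    tvNorm ρ ν ≤ ENNReal.ofReal (2 * a) := by
  set s := ρ.toSignedMeasure - ν.toSignedMeasure with hs
  have hsA : ∀ A, MeasurableSet A → s A = ρ.real A - ν.real A := fun A hA =>
    Measure.toSignedMeasure_sub_apply hA
  obtain ⟨i, hi, h1, h2, h3, h4⟩ := s.toJordanDecomposition_spec
  have h0 : 0 ≤ s i := VectorMeasure.nonneg_of_zero_le_restrict s h1
  have hc : -s iᶜ = s i := by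
    rw [hsA _ hi, hsA _ hi.compl, probReal_compl_eq_one_sub hi, probReal_compl_eq_one_sub hi]
    ring
  have hp : s.toJordanDecomposition.posPart univ = ENNReal.ofReal (s i) := by
    rw [h3, SignedMeasure.toMeasureOfZeroLE_apply _ h1 hi MeasurableSet.univ, ENNReal.ofReal,
      Real.toNNReal_of_nonneg h0]
    simp only [inter_univ]
  have hn : s.toJordanDecomposition.negPart univ = ENNReal.ofReal (-s iᶜ) := by
    rw [h4, SignedMeasure.toMeasureOfLEZero_apply _ h2 hi.compl MeasurableSet.univ,
      ENNReal.ofReal, Real.toNNReal_of_nonneg (hc ▸ h0)]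
    simp only [inter_univ]
  rw [tvNorm, ← hs, SignedMeasure.totalVariation, Measure.add_apply, hp, hn, hc,
    ← ENNReal.ofReal_add h0 h0]
  refine ENNReal.ofReal_le_ofReal ?_
  have := h i hi
  rw [← hsA i hi] at this
  linarith

theorem ofReal_real_sub_le_tvNorm (ρ ν : Measure S) [IsFiniteMeasure ρ] [IsFiniteMeasure ν]
    {A : Set S} (hA : MeasurableSet A) : ENNReal.ofReal (ρ.real A - ν.real A) ≤ tvNorm ρ ν := by
  set s := ρ.toSignedMeasure - ν.toSignedMeasure with hs
  have hsA : s A = ρ.real A - ν.real A := Measure.toSignedMeasure_sub_apply hA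
  calc ENNReal.ofReal (ρ.real A - ν.real A) ≤ ‖s A‖ₑ := by
        rw [← hsA, ← ofReal_norm]; exact ENNReal.ofReal_le_ofReal (Real.le_norm_self _)
    _ ≤ s.totalVariation A := s.enorm_le_totalVariation A
    _ ≤ tvNorm ρ ν := measure_mono (subset_univ _)

end TotalVariation

/-! ### Positivity, norms and spectral radii of kernel operators. -/

section Operators

namespace BoundedMeasurable

variable {𝕜 : Type*} [RCLike 𝕜] [MeasurableSpace 𝕜] [BorelSpace 𝕜]
variable {X : Type*} [MeasurableSpace X]

theorem norm_le_of_forall_le {f : BoundedMeasurable 𝕜 X} {C : ℝ} (hC : 0 ≤ C)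
    (h : ∀ x, ‖f x‖ ≤ C) : ‖f‖ ≤ C :=
  lp.norm_le_of_forall_le hC h

theorem ext_apply {f g : BoundedMeasurable 𝕜 X} (h : ∀ x, f x = g x) : f = g :=
  Subtype.ext (lp.ext (funext h))

@[simp] theorem one_apply (x : X) : one 𝕜 X x = 1 := rfl

theorem norm_one_le : ‖one 𝕜 X‖ ≤ 1 := norm_le_of_forall_le zero_le_one fun x => by simp

/-- Uniform limits of measurable functions are measurable. Completeness is what Gelfand's formula
needs. -/
instance : CompleteSpace (BoundedMeasurable 𝕜 X) := by
  have hclosed : IsClosed (BoundedMeasurable 𝕜 X : Set (lp (fun _ : X => 𝕜) ∞)) := by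
    refine IsSeqClosed.isClosed fun f g hf hfg => ?_
    refine measurable_of_tendsto_metrizable (fun n => hf n) (tendsto_pi_nhds.2 fun x => ?_)
    rw [tendsto_iff_norm_sub_tendsto_zero] at hfg ⊢
    exact squeeze_zero (fun _ => norm_nonneg _)
      (fun n => lp.norm_apply_le_norm ENNReal.top_ne_zero (f n - g) x) hfg
  exact hclosed.completeSpace_coe

end BoundedMeasurable

open BoundedMeasurable

variable {X : Type*} [MeasurableSpace X]

theorem kernelOp_mono (Q : Kernel X X) (hQ : ∀ x, Q x univ ≤ 1) {f g : BoundedMeasurable ℝ X}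
    (h : ∀ x, f x ≤ g x) (x : X) : kernelOp ℝ Q hQ f x ≤ kernelOp ℝ Q hQ g x := by
  have : IsFiniteMeasure (Q x) := ⟨(hQ x).trans_lt ENNReal.one_lt_top⟩
  exact integral_mono (integrable f (Q x)) (integrable g (Q x)) h

theorem kernelOp_iterate_mono (Q : Kernel X X) (hQ : ∀ x, Q x univ ≤ 1) (n : ℕ)
    {f g : BoundedMeasurable ℝ X} (h : ∀ x, f x ≤ g x) (x : X) :
    (kernelOp ℝ Q hQ)^[n] f x ≤ (kernelOp ℝ Q hQ)^[n] g x := by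
  induction n generalizing x with
  | zero => exact h x
  | succ n ih =>
    rw [Function.iterate_succ_apply', Function.iterate_succ_apply']
    exact kernelOp_mono Q hQ ih x

variable {𝕜 : Type*} [RCLike 𝕜] [MeasurableSpace 𝕜] [BorelSpace 𝕜]

/-- Links the real operator in the integrals with the complex one whose spectral radius is taken. -/
theorem kernelOp_iterate_one_ofReal (Q : Kernel X X) (hQ : ∀ x, Q x univ ≤ 1) (n : ℕ) (x : X) :
    (kernelOp 𝕜 Q hQ)^[n] (one 𝕜 X) x = ((kernelOp ℝ Q hQ)^[n] (one ℝ X) x : 𝕜) := by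
  induction n generalizing x with
  | zero => simp
  | succ n ih =>
    rw [Function.iterate_succ_apply', Function.iterate_succ_apply', kernelOp_apply,
      kernelOp_apply, ← integral_ofReal]
    exact integral_congr_ae (Eventually.of_forall ih)

variable (𝕜) in
theorem kernelOp_iterate_one_le_norm (Q : Kernel X X) (hQ : ∀ x, Q x univ ≤ 1) (n : ℕ) (x : X) :
    (kernelOp ℝ Q hQ)^[n] (one ℝ X) x ≤ ‖(kernelOp 𝕜 Q hQ)^[n] (one 𝕜 X)‖ := by
  refine le_trans ?_ (norm_apply_le _ x)
  rw [kernelOp_iterate_one_ofReal (𝕜 := 𝕜), RCLike.norm_ofReal]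
  exact le_abs_self _

theorem norm_kernelOp_le (Q : Kernel X X) (hQ : ∀ x, Q x univ ≤ 1) {C : ℝ} (hC : 0 ≤ C)
    (h : ∀ x, Q x univ ≤ ENNReal.ofReal C) : ‖kernelOp 𝕜 Q hQ‖ ≤ C := by
  refine ContinuousLinearMap.opNorm_le_bound _ hC fun f =>
    norm_le_of_forall_le (by positivity) fun x => ?_
  have : IsFiniteMeasure (Q x) := ⟨(hQ x).trans_lt ENNReal.one_lt_top⟩
  rw [kernelOp_apply]
  refine (norm_integral_le_of_norm_le_const (C := ‖f‖)
    (Eventually.of_forall (norm_apply_le f))).trans ?_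
  rw [mul_comm]
  exact mul_le_mul_of_nonneg_right (ENNReal.toReal_le_of_le_ofReal hC (h x)) (norm_nonneg _)

/-- Using Gelfand's formula with `n ≥ 1` includes the zero space, where the identity has norm 0; it
occurs for `V̂` when `S` has one point. -/
theorem spectralRadius_le_ofReal_of_opNorm_le {E : Type*} [NormedAddCommGroup E]
    [NormedSpace ℂ E] [CompleteSpace E] {a : E →L[ℂ] E} {C : ℝ} (h : ‖a‖ ≤ C) :
    spectralRadius ℂ a ≤ ENNReal.ofReal C := by
  refine le_of_tendsto (spectrum.pow_norm_pow_one_div_tendsto_nhds_spectralRadius a) ?_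
  filter_upwards [eventually_ge_atTop 1] with n hn
  refine ENNReal.ofReal_le_ofReal (le_trans ?_ h)
  have hn0 : n ≠ 0 := by omega
  rw [one_div]
  refine (Real.rpow_le_rpow (norm_nonneg _) (norm_pow_le' a hn) (by positivity)).trans ?_
  rw [Real.pow_rpow_inv_natCast (norm_nonneg _) hn0]

theorem spectralRadius_le_of_norm_pow_le {A B : Type*} [NormedRing A] [NormedAlgebra ℂ A]
    [CompleteSpace A] [NormedRing B] [NormedAlgebra ℂ B] [CompleteSpace B] {a : A} {b : B}
    (h : ∀ n, 1 ≤ n → ‖a ^ n‖ ≤ ‖b ^ n‖) : spectralRadius ℂ a ≤ spectralRadius ℂ b := by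
  refine le_of_tendsto_of_tendsto (spectrum.pow_norm_pow_one_div_tendsto_nhds_spectralRadius a)
    (spectrum.pow_norm_pow_one_div_tendsto_nhds_spectralRadius b) ?_
  filter_upwards [eventually_ge_atTop 1] with n hn
  exact ENNReal.ofReal_le_ofReal (Real.rpow_le_rpow (norm_nonneg _) (h n hn) (by positivity))

theorem norm_iterate_le_of_spectralRadius_lt {E : Type*} [NormedAddCommGroup E] [NormedSpace ℂ E]
    [CompleteSpace E] {T : E →L[ℂ] E} {c : ℝ} (hc : 0 < c)
    (h : spectralRadius ℂ T < ENNReal.ofReal c) (f : E) :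
    ∀ᶠ n : ℕ in atTop, ‖T^[n] f‖ ≤ c ^ n * ‖f‖ := by
  filter_upwards [(spectrum.pow_norm_pow_one_div_tendsto_nhds_spectralRadius T).eventually_lt_const
    h, eventually_ge_atTop 1] with n hn hn1
  have hn0 : n ≠ 0 := by omega
  rw [ENNReal.ofReal_lt_ofReal_iff hc, one_div] at hn
  have h1 : ‖T ^ n‖ ≤ c ^ n := by
    rw [← Real.rpow_inv_natCast_pow (norm_nonneg (T ^ n)) hn0]
    exact pow_le_pow_left₀ (by positivity) hn.le n
  rw [← FunLike.coe_pow_eq_iterate]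
  exact (ContinuousLinearMap.le_opNorm _ _).trans
    (mul_le_mul_of_nonneg_right h1 (norm_nonneg _))

/-- The inner factors `ρ ∘ ι` cancel in powers, so `T ^ n` and `T' ^ n` are obtained from each other
by composing with contractions. This needs `n ≥ 1`, since `ι ∘ ρ` need not be the identity. -/
theorem spectralRadius_eq_of_conj {E F : Type*} [NormedAddCommGroup E] [NormedSpace ℂ E]
    [CompleteSpace E] [NormedAddCommGroup F] [NormedSpace ℂ F] [CompleteSpace F]
    {T : E →L[ℂ] E} {T' : F →L[ℂ] F} {ι : F →L[ℂ] E} {ρ : E →L[ℂ] F}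
    (hι : ‖ι‖ ≤ 1) (hρ : ‖ρ‖ ≤ 1) (hρι : ρ ∘L ι = ContinuousLinearMap.id ℂ F)
    (hT : T = ι ∘L T' ∘L ρ) : spectralRadius ℂ T = spectralRadius ℂ T' := by
  have hpow : ∀ n, T ^ (n + 1) = ι ∘L (T' ^ (n + 1)) ∘L ρ := by
    intro n
    induction n with
    | zero => simpa using hT
    | succ n ih =>
      rw [pow_succ, ih, pow_succ _ (n + 1)]
      ext f
      have h1 : ∀ g, ρ (ι g) = g := fun g => DFunLike.congr_fun hρι g
      simp [hT, h1]
  have hpow' : ∀ n, T' ^ (n + 1) = ρ ∘L (T ^ (n + 1)) ∘L ι := by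
    intro n
    have h1 : ∀ g, ρ (ι g) = g := fun g => DFunLike.congr_fun hρι g
    rw [hpow]
    ext f
    simp [h1]
  refine le_antisymm (spectralRadius_le_of_norm_pow_le fun n hn => ?_)
    (spectralRadius_le_of_norm_pow_le fun n hn => ?_)
  · obtain ⟨n, rfl⟩ := Nat.exists_eq_add_of_le' hn
    rw [hpow]
    calc _ ≤ ‖ι‖ * (‖T' ^ (n + 1)‖ * ‖ρ‖) := (ContinuousLinearMap.opNorm_comp_le _ _).trans
          (by gcongr; exact ContinuousLinearMap.opNorm_comp_le _ _)
      _ ≤ 1 * (‖T' ^ (n + 1)‖ * 1) := by gcongr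
      _ = _ := by ring
  · obtain ⟨n, rfl⟩ := Nat.exists_eq_add_of_le' hn
    rw [hpow']
    calc _ ≤ ‖ρ‖ * (‖T ^ (n + 1)‖ * ‖ι‖) := (ContinuousLinearMap.opNorm_comp_le _ _).trans
          (by gcongr; exact ContinuousLinearMap.opNorm_comp_le _ _)
      _ ≤ 1 * (‖T ^ (n + 1)‖ * 1) := by gcongr
      _ = _ := by ring

end Operators

/-! ### The coupling intertwines differences, and the total variation bound. -/

section Coupling

open BoundedMeasurable

variable {S : Type*} [MeasurableSpace S] (P : Kernel S S) (m : ℕ)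

/-- Mutual singularity of the two excess measures: at each point at least one of `p - p ∧ q`, `q - p
∧ q` is zero, and `{q < p}` separates them. -/
theorem exists_excess_eq_zero (x x' : S) :
    ∃ A, MeasurableSet A ∧ excess P m x x' Aᶜ = 0 ∧ excess P m x' x A = 0 := by
  set p := ((P ^ m) x).rnDeriv ((P ^ m) x + (P ^ m) x') with hp
  set q := ((P ^ m) x').rnDeriv ((P ^ m) x + (P ^ m) x') with hq
  have hA : MeasurableSet {y | q y < p y} :=
    measurableSet_lt (Measure.measurable_rnDeriv _ _) (Measure.measurable_rnDeriv _ _)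
  refine ⟨{y | q y < p y}, hA, ?_, ?_⟩
  · rw [excess, withDensity_apply _ hA.compl]
    refine (setLIntegral_congr_fun hA.compl fun y hy => ?_).trans lintegral_zero
    have hy' : p y ≤ q y := not_lt.1 hy
    simp only [← hp, ← hq, min_eq_left hy', tsub_self]
  · rw [excess, withDensity_apply _ hA, add_comm ((P ^ m) x')]
    refine (setLIntegral_congr_fun hA fun y hy => ?_).trans lintegral_zero
    have hy' : q y < p y := hy
    simp only [← hp, ← hq, min_eq_left hy'.le, tsub_self]

/-- The common part of the `m`-step transition probabilities from two states. -/
noncomputable def commonPart (P : Kernel S S) (m : ℕ) (x x' : S) : Measure S :=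
  ((P ^ m) x + (P ^ m) x').withDensity fun y =>
    min (((P ^ m) x).rnDeriv ((P ^ m) x + (P ^ m) x') y)
      (((P ^ m) x').rnDeriv ((P ^ m) x + (P ^ m) x') y)

theorem commonPart_comm (x x' : S) : commonPart P m x x' = commonPart P m x' x := by
  rw [commonPart, commonPart, add_comm ((P ^ m) x)]
  simp_rw [min_comm]

theorem invariant_pow {μ : Measure S} (hμ : P.Invariant μ) (n : ℕ) : (P ^ n).Invariant μ := by
  induction n with
  | zero => exact Measure.bind_dirac
  | succ n ih => rw [pow_succ]; exact ih.comp hμ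

theorem excess_self (x : S) : excess P m x x = 0 := by
  obtain ⟨A, hA, h1, h2⟩ := exists_excess_eq_zero P m x x
  rw [← Measure.measure_univ_eq_zero, ← union_compl_self A]
  exact measure_union_null h2 h1

variable [IsMarkovKernel P]

theorem uncoupledLaw_diag (x : S) : uncoupledLaw P m (x, x) = 0 := by
  rw [uncoupledLaw_eq]
  simp [excess_self]

/-- With `A` separating the excesses, a point `(y, y)` has its first coordinate outside `A` or its
second inside; both events are null. -/
theorem uncoupledLaw_setOf_eq (x : S × S) : uncoupledLaw P m x {y | y.1 = y.2} = 0 := by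
  obtain ⟨A, hA, h1, h2⟩ := exists_excess_eq_zero P m x.1 x.2
  rw [uncoupledLaw_eq, Measure.smul_apply, smul_eq_mul]
  refine mul_eq_zero_of_right _ (measure_mono_null (t := Aᶜ ×ˢ univ ∪ univ ×ˢ A) ?_ ?_)
  · intro y hy
    by_cases h : y.2 ∈ A
    · exact Or.inr ⟨mem_univ _, h⟩
    · refine Or.inl ⟨?_, mem_univ _⟩
      rw [mem_compl_iff, show y.1 = y.2 from hy]
      exact h
  · refine measure_union_null ?_ ?_
    · rw [Measure.prod_prod, h1, zero_mul]
    · rw [Measure.prod_prod, h2, mul_zero]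

theorem excess_add_commonPart (x x' : S) :
    excess P m x x' + commonPart P m x x' = (P ^ m) x := by
  have hμ : (P ^ m) x ≪ (P ^ m) x + (P ^ m) x' :=
    Measure.absolutelyContinuous_of_le (Measure.le_add_right le_rfl)
  rw [excess, commonPart, ← withDensity_add_right _ (by fun_prop)]
  refine Eq.trans ?_ (Measure.withDensity_rnDeriv_eq _ _ hμ)
  congr 1
  ext y
  exact tsub_add_cancel_of_le (min_le_left _ _)

instance (x x' : S) : IsFiniteMeasure (commonPart P m x x') := by
  refine ⟨lt_of_le_of_lt ?_ (measure_lt_top ((P ^ m) x) univ)⟩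
  rw [← excess_add_commonPart P m x x', Measure.add_apply]
  exact le_add_self

/-- On the set `A` carrying the excess of `x`, the law from `x'` reduces to the common part, so the
two laws differ there by exactly the excess mass `1 - α`. -/
theorem one_sub_overlap_le_tvNorm (x x' : S) :
    1 - overlap P m x x' ≤ tvNorm ((P ^ m) x) ((P ^ m) x') := by
  obtain ⟨A, hA, h1, h2⟩ := exists_excess_eq_zero P m x x'
  have h3 : excess P m x x' univ = excess P m x x' A := by
    refine le_antisymm ?_ (measure_mono (subset_univ _))
    rw [← union_compl_self A]
    exact (measure_union_le _ _).trans (by rw [h1, add_zero])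
  rw [← excess_univ, h3]
  refine le_trans ?_ (ofReal_real_sub_le_tvNorm _ _ hA)
  have e1 : ((P ^ m) x).real A = (excess P m x x').real A + (commonPart P m x x').real A := by
    conv_lhs => rw [← excess_add_commonPart P m x x']
    exact measureReal_add_apply
  have e2 : ((P ^ m) x').real A = (commonPart P m x x').real A := by
    conv_lhs => rw [← excess_add_commonPart P m x' x, commonPart_comm]
    rw [measureReal_add_apply, measureReal_def, h2, ENNReal.toReal_zero, zero_add]
  rw [e1, e2, add_sub_cancel_right, measureReal_def, ENNReal.ofReal_toReal (measure_ne_top _ _)]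

/-- The function `(x, x') ↦ f x - f x'`. -/
noncomputable def pairDiff (f : BoundedMeasurable ℝ S) : BoundedMeasurable ℝ (S × S) :=
  BoundedMeasurable.mk (fun x => f x.1 - f x.2)
    ((Measurable.comp f.2 measurable_fst).sub (Measurable.comp f.2 measurable_snd))
    (‖f‖ + ‖f‖) fun x => (norm_sub_le _ _).trans <|
      add_le_add (norm_apply_le f x.1) (norm_apply_le f x.2)

theorem pairDiff_apply (f : BoundedMeasurable ℝ S) (x : S × S) :
    pairDiff f x = f x.1 - f x.2 := rfl

/-- The transition operator `f ↦ (x ↦ ∫ f(y) P_x(m, dy))`. -/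
noncomputable def transitionOp : BoundedMeasurable ℝ S →L[ℝ] BoundedMeasurable ℝ S :=
  kernelOp ℝ (P ^ m) fun _ => prob_le_one

theorem transitionOp_apply (f : BoundedMeasurable ℝ S) (x : S) :
    transitionOp P m f x = ∫ y, f y ∂((P ^ m) x) := rfl

theorem transitionOp_transitionOp (a b : ℕ) (f : BoundedMeasurable ℝ S) :
    transitionOp P a (transitionOp P b f) = transitionOp P (a + b) f := by
  refine ext_apply fun x => ?_
  have h : P ^ (a + b) = (P ^ b) ∘ₖ (P ^ a) := by rw [add_comm, pow_add]; rfl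
  rw [transitionOp_apply, transitionOp_apply, h, Kernel.integral_comp]
  · rfl
  · exact integrable f _

theorem transitionOp_iterate (n : ℕ) (f : BoundedMeasurable ℝ S) :
    (transitionOp P m)^[n] f = transitionOp P (n * m) f := by
  induction n with
  | zero =>
    refine ext_apply fun x => ?_
    rw [transitionOp_apply, zero_mul, pow_zero]
    exact (integral_dirac' _ _ (Measurable.stronglyMeasurable f.2)).symm
  | succ n ih =>
    rw [Function.iterate_succ_apply', ih, transitionOp_transitionOp, Nat.succ_mul, add_comm]

theorem integral_transitionOp {μ : Measure S} [IsProbabilityMeasure μ] (hμ : P.Invariant μ)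
    (n : ℕ) (f : BoundedMeasurable ℝ S) : ∫ x, transitionOp P n f x ∂μ = ∫ x, f x ∂μ := by
  have h : ((P ^ n) ∘ₖ Kernel.const Unit μ) () = μ := by
    rw [← Measure.comp_eq_comp_const_apply]
    exact (invariant_pow P hμ n).def
  have hf : Integrable (f : S → ℝ) (((P ^ n) ∘ₖ Kernel.const Unit μ) ()) := by
    rw [h]; exact integrable f μ
  have h2 := Kernel.integral_comp hf
  rw [h] at h2
  exact h2.symm

variable (hP : MeasurableCoupling P)

/-- The common part drops out of the difference of expectations. Each excess has mass `1 - α`, so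
integrating a function of one coordinate against their product produces a factor `1 - α`, which the
normalisation removes. -/
theorem opV_pairDiff (f : BoundedMeasurable ℝ S) :
    opV ℝ P hP m (pairDiff f) = pairDiff (transitionOp P m f) := by
  refine ext_apply fun x => ?_
  rw [pairDiff_apply, transitionOp_apply, transitionOp_apply]
  change ∫ y, pairDiff f y ∂(uncoupledLaw P m x) = _
  have hR : ∫ y, f y ∂((P ^ m) x.1) - ∫ y, f y ∂((P ^ m) x.2) =
      ∫ y, f y ∂(excess P m x.1 x.2) - ∫ y, f y ∂(excess P m x.2 x.1) := by
    rw [← excess_add_commonPart P m x.1 x.2, ← excess_add_commonPart P m x.2 x.1,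
      integral_add_measure (integrable f _) (integrable f _),
      integral_add_measure (integrable f _) (integrable f _), commonPart_comm P m x.2]
    ring
  rw [hR, uncoupledLaw_eq, integral_smul_measure]
  have hL : ∫ y, pairDiff f y ∂((excess P m x.1 x.2).prod (excess P m x.2 x.1)) =
      (1 - overlap P m x.1 x.2).toReal *
        (∫ y, f y ∂(excess P m x.1 x.2) - ∫ y, f y ∂(excess P m x.2 x.1)) := by
    simp_rw [pairDiff_apply]
    rw [integral_sub ((integrable f _).comp_fst _) ((integrable f _).comp_snd _),
      integral_fun_fst, integral_fun_snd, measureReal_def, measureReal_def, excess_univ,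
      excess_univ, overlap_comm P m x.2, smul_eq_mul, smul_eq_mul]
    ring
  rw [hL, ENNReal.toReal_inv, smul_eq_mul]
  -- When the overlap is full the inverse is only a default value, but both excesses vanish and both
  -- sides are 0.
  rcases eq_or_ne (1 - overlap P m x.1 x.2) 0 with h0 | h0
  · have h1 : excess P m x.1 x.2 = 0 := by
      rw [← Measure.measure_univ_eq_zero, excess_univ, h0]
    have h2 : excess P m x.2 x.1 = 0 := by
      rw [← Measure.measure_univ_eq_zero, excess_univ, overlap_comm P m x.2, h0]
    simp [h1, h2]
  · rw [inv_mul_cancel_left₀ (ENNReal.toReal_ne_zero.2 ⟨h0, by finiteness⟩)]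

theorem opV_iterate_pairDiff (n : ℕ) (f : BoundedMeasurable ℝ S) :
    (opV ℝ P hP m)^[n] (pairDiff f) = pairDiff (transitionOp P (n * m) f) := by
  rw [← transitionOp_iterate]
  exact (Function.Semiconj.iterate_right (f := pairDiff)
    (fun f => (opV_pairDiff P m hP f).symm) n f).symm

theorem tvNorm_pow_le {μ : Measure S} [IsProbabilityMeasure μ] (hμ : P.Invariant μ) (x₁ : S)
    (k j : ℕ) : tvNorm ((P ^ (k * m + j)) x₁) μ ≤ ENNReal.ofReal
      (∫ x₂, 2 * ((opV ℝ P hP m)^[k] (one ℝ (S × S)) (x₁, x₂)) ∂μ) := by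
  rw [integral_const_mul]
  refine tvNorm_le_of_forall_real_sub_le _ _ fun A hA => ?_
  set g : BoundedMeasurable ℝ S := BoundedMeasurable.mk (A.indicator 1)
    (measurable_one.indicator hA) 1 (fun x => by
      by_cases h : x ∈ A <;> simp [h]) with hg
  have hgi : ∀ ρ : Measure S, ∫ y, g y ∂ρ = ρ.real A := fun ρ => integral_indicator_one hA
  -- The remainder `j` is absorbed here: averaging keeps the values of the indicator in `[0, 1]`, so
  -- differences stay below 1.
  set h := transitionOp P j g with hh
  have h0 : ∀ x, 0 ≤ h x := fun x => by
    rw [hh, transitionOp_apply, hgi]; exact measureReal_nonneg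
  have h1 : ∀ x, h x ≤ 1 := fun x => by
    rw [hh, transitionOp_apply, hgi]; exact measureReal_le_one
  have hle : ∀ x, pairDiff h x ≤ one ℝ (S × S) x := fun x => by
    rw [pairDiff_apply, one_apply]; linarith [h0 x.2, h1 x.1]
  have key : ∀ x₂, transitionOp P (k * m + j) g x₁ - transitionOp P (k * m + j) g x₂ ≤
      (opV ℝ P hP m)^[k] (one ℝ (S × S)) (x₁, x₂) := fun x₂ => by
    have := kernelOp_iterate_mono (uncoupledKernel P hP m) (uncoupledLaw_univ_le P m) k hle (x₁, x₂)
    refine le_trans (le_of_eq ?_) this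
    change _ = (opV ℝ P hP m)^[k] (pairDiff h) (x₁, x₂)
    rw [opV_iterate_pairDiff, pairDiff_apply, hh, transitionOp_transitionOp]
  have hint : Integrable (fun x₂ => (opV ℝ P hP m)^[k] (one ℝ (S × S)) (x₁, x₂)) μ :=
    Integrable.of_bound (Measurable.aestronglyMeasurable
      (Measurable.comp ((opV ℝ P hP m)^[k] (one ℝ (S × S))).2 measurable_prodMk_left))
      ‖(opV ℝ P hP m)^[k] (one ℝ (S × S))‖ (Eventually.of_forall fun x₂ => norm_apply_le _ _)
  have h2 := integral_mono (((integrable_const _).sub (integrable _ μ))) hint key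
  simp only [Pi.sub_apply] at h2
  rw [integral_sub (integrable_const _) (integrable _ μ), integral_transitionOp P hμ, hgi] at h2
  simpa [transitionOp_apply, hgi] using h2

theorem integral_opV_iterate_one_le (μ : Measure S) [IsProbabilityMeasure μ] (x₁ : S) (k : ℕ) :
    ∫ x₂, 2 * ((opV ℝ P hP m)^[k] (one ℝ (S × S)) (x₁, x₂)) ∂μ ≤
      2 * ‖(opV ℂ P hP m)^[k] (one ℂ (S × S))‖ := by
  refine (Real.le_norm_self _).trans ?_
  refine (norm_integral_le_of_norm_le_const (C := 2 * ‖(opV ℂ P hP m)^[k] (one ℂ (S × S))‖)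
    (Eventually.of_forall fun x₂ => ?_)).trans (by simp)
  have h0 : (0 : ℝ) ≤ (opV ℝ P hP m)^[k] (one ℝ (S × S)) (x₁, x₂) := by
    have := kernelOp_iterate_mono (uncoupledKernel P hP m) (uncoupledLaw_univ_le P m) k
      (f := 0) (g := one ℝ (S × S)) (fun x => zero_le_one) (x₁, x₂)
    refine le_trans (le_of_eq ?_) this
    rw [Function.iterate_fixed (ContinuousLinearMap.map_zero _)]
    rfl
  rw [Real.norm_of_nonneg (by positivity)]
  exact mul_le_mul_of_nonneg_left
    (kernelOp_iterate_one_le_norm ℂ (uncoupledKernel P hP m) (uncoupledLaw_univ_le P m) k _)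
    zero_le_two

end Coupling

/-! ### Removing the diagonal and comparing spectral radii. -/

section OffDiagonal

open BoundedMeasurable

theorem extend_offDiag_apply {S E : Type*} [Zero E] (f : OffDiag S → E) (x : OffDiag S) :
    Function.extend Subtype.val f 0 x.1 = f x :=
  Subtype.val_injective.extend_apply f 0 x

theorem extend_offDiag_apply_of_eq {S E : Type*} [Zero E] (f : OffDiag S → E) {x : S × S}
    (hx : x.1 = x.2) : Function.extend Subtype.val f 0 x = 0 :=
  Function.extend_apply' _ _ _ fun ⟨y, hy⟩ => y.2 (by rw [hy]; exact hx)

variable {S : Type*} [MeasurableSpace S]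
variable (𝕜 : Type*) [RCLike 𝕜] [MeasurableSpace 𝕜] [BorelSpace 𝕜]

variable (S) in
/-- Restriction of bounded measurable functions to the complement of the diagonal. -/
noncomputable def restrictOffDiag :
    BoundedMeasurable 𝕜 (S × S) →L[𝕜] BoundedMeasurable 𝕜 (OffDiag S) :=
  LinearMap.mkContinuous
    { toFun := fun f => BoundedMeasurable.mk (fun x => f x.1)
        (Measurable.comp f.2 measurable_subtype_coe) ‖f‖ fun x => norm_apply_le f x.1
      map_add' := fun _ _ => rfl
      map_smul' := fun _ _ => rfl }
    1 fun f => by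
      rw [one_mul]
      exact norm_le_of_forall_le (norm_nonneg _) fun x => norm_apply_le f x.1

variable {𝕜} in
theorem norm_extend_le (f : BoundedMeasurable 𝕜 (OffDiag S)) (x : S × S) :
    ‖Function.extend Subtype.val (f : OffDiag S → 𝕜) 0 x‖ ≤ ‖f‖ := by
  by_cases hx : x.1 = x.2
  · rw [extend_offDiag_apply_of_eq _ hx, norm_zero]; exact norm_nonneg _
  · rw [extend_offDiag_apply _ ⟨x, hx⟩]; exact norm_apply_le f _

variable [MeasurableEq S]

variable (S) in
/-- Extension of bounded measurable functions by zero to the diagonal. -/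
noncomputable def extendOffDiag :
    BoundedMeasurable 𝕜 (OffDiag S) →L[𝕜] BoundedMeasurable 𝕜 (S × S) :=
  LinearMap.mkContinuous
    { toFun := fun f => BoundedMeasurable.mk (Function.extend Subtype.val (f : OffDiag S → 𝕜) 0)
        (measurableEmbedding_offDiag.measurable_extend f.2 measurable_zero) ‖f‖ (norm_extend_le f)
      map_add' := fun f g => by
        refine ext_apply fun x => ?_
        change Function.extend Subtype.val ((f + g : BoundedMeasurable 𝕜 (OffDiag S)) :
            OffDiag S → 𝕜) 0 x = Function.extend Subtype.val (f : OffDiag S → 𝕜) 0 x +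
          Function.extend Subtype.val (g : OffDiag S → 𝕜) 0 x
        by_cases hx : x.1 = x.2
        · simp only [extend_offDiag_apply_of_eq _ hx, add_zero]
        · simp only [extend_offDiag_apply _ ⟨x, hx⟩]; rfl
      map_smul' := fun c f => by
        refine ext_apply fun x => ?_
        change Function.extend Subtype.val ((c • f : BoundedMeasurable 𝕜 (OffDiag S)) :
            OffDiag S → 𝕜) 0 x = c * Function.extend Subtype.val (f : OffDiag S → 𝕜) 0 x
        by_cases hx : x.1 = x.2
        · simp only [extend_offDiag_apply_of_eq _ hx, mul_zero]
        · simp only [extend_offDiag_apply _ ⟨x, hx⟩]; rfl }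
    1 fun f => by
      rw [one_mul]
      exact norm_le_of_forall_le (norm_nonneg _) (norm_extend_le f)

theorem extendOffDiag_apply (f : BoundedMeasurable 𝕜 (OffDiag S)) (x : S × S) :
    extendOffDiag S 𝕜 f x = Function.extend Subtype.val (f : OffDiag S → 𝕜) 0 x := rfl

variable (P : Kernel S S) [IsMarkovKernel P] (hP : MeasurableCoupling P) (m : ℕ)

/-- On the diagonal the uncoupled law is zero; off it, that law is concentrated off the diagonal, so
only the restriction of `f` matters. -/
theorem opV_eq_extend_opVhat_restrict (f : BoundedMeasurable 𝕜 (S × S)) :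
    opV 𝕜 P hP m f = extendOffDiag S 𝕜 (opVhat 𝕜 P hP m (restrictOffDiag S 𝕜 f)) := by
  refine ext_apply fun x => ?_
  rw [extendOffDiag_apply]
  by_cases hx : x.1 = x.2
  · rw [extend_offDiag_apply_of_eq _ hx]
    change ∫ y, f y ∂(uncoupledLaw P m x) = 0
    have : uncoupledLaw P m x = 0 := by
      obtain ⟨a, b⟩ := x
      obtain rfl : a = b := hx
      exact uncoupledLaw_diag P m a
    rw [this, integral_zero_measure]
  · rw [extend_offDiag_apply _ ⟨x, hx⟩]
    change ∫ y, f y ∂(uncoupledLaw P m x) =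
      ∫ y : OffDiag S, f y.1 ∂((uncoupledLaw P m x).comap Subtype.val)
    rw [← measurableEmbedding_offDiag.integral_map (g := (f : S × S → 𝕜)),
      measurableEmbedding_offDiag.map_comap, Measure.restrict_eq_self_of_ae_mem]
    rw [ae_iff]
    refine measure_mono_null (fun y hy => ?_) (uncoupledLaw_setOf_eq P m x)
    by_contra h
    exact hy ⟨⟨y, h⟩, rfl⟩

theorem spectralRadius_opV_eq :
    spectralRadius ℂ (opV ℂ P hP m) = spectralRadius ℂ (opVhat ℂ P hP m) := by
  refine spectralRadius_eq_of_conj (ι := extendOffDiag S ℂ) (ρ := restrictOffDiag S ℂ)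
    (LinearMap.mkContinuous_norm_le _ zero_le_one _)
    (LinearMap.mkContinuous_norm_le _ zero_le_one _) ?_ ?_
  · refine ContinuousLinearMap.ext fun f => ext_apply fun x => ?_
    exact extend_offDiag_apply _ x
  · exact ContinuousLinearMap.ext fun f => opV_eq_extend_opVhat_restrict ℂ P hP m f

theorem spectralRadius_opVhat_le {C : ℝ} (hC : 0 ≤ C)
    (h : ∀ x x', 1 - overlap P m x x' ≤ ENNReal.ofReal C) :
    spectralRadius ℂ (opVhat ℂ P hP m) ≤ ENNReal.ofReal C := by
  refine spectralRadius_le_ofReal_of_opNorm_le (norm_kernelOp_le _ _ hC fun x => ?_)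
  rw [uncoupledKernelHat, Kernel.comapRight_apply' _ _ _ MeasurableSet.univ]
  refine (measure_mono (subset_univ _)).trans ?_
  change uncoupledLaw P m x.1 univ ≤ _
  refine le_trans (le_of_eq ?_) (h x.1.1 x.1.2)
  simp [uncoupledLaw]

end OffDiagonal

/-! ### Growth rates and assembly of the theorem. -/

section Main

open BoundedMeasurable

variable {S : Type*} [MeasurableSpace S] (P : Kernel S S) [IsMarkovKernel P]
variable (hP : MeasurableCoupling P)

theorem limsup_log_tvNorm_le {μ : Measure S} [IsProbabilityMeasure μ] (hμ : P.Invariant μ)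
    (x₁ : S) {m : ℕ} (hm : 1 ≤ m) :
    limsup (fun n : ℕ => ENNReal.log (tvNorm ((P ^ n) x₁) μ) / (n : EReal)) atTop
      ≤ limsup (fun n : ℕ => ENNReal.log (ENNReal.ofReal
          (∫ x₂, 2 * ((opV ℝ P hP m)^[n] (one ℝ (S × S)) (x₁, x₂)) ∂μ))
          / ((n * m : ℕ) : EReal)) atTop := by
  -- Comparing with every real `c` above the right-hand side also covers the value `-∞` coming from
  -- `ln 0`.
  refine EReal.le_of_forall_lt_iff_le.1 fun c hc => ?_
  refine limsup_log_div_le_of_eventually_le (d := fun n => n) tendsto_id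
    -- Replacing `n` by the multiple `n / m * m` changes the exponent `c * n` by at most `|c| * m`,
    -- whatever the sign of `c`.
    (Real.exp_pos (|c| * m)) ?_
  have hdiv : Tendsto (fun n : ℕ => n / m) atTop atTop := Nat.tendsto_div_const_atTop (by omega)
  filter_upwards [hdiv.eventually (eventually_lt_of_limsup_lt hc), hdiv.eventually_ge_atTop 1]
    with n hn hn1
  have h1 := tvNorm_pow_le P m hP hμ x₁ (n / m) (n % m)
  rw [Nat.div_add_mod'] at h1
  refine h1.trans ((le_ofReal_exp_of_log_div_le
    (Nat.mul_pos (by omega) (by omega)) hn.le).trans (ENNReal.ofReal_le_ofReal ?_))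
  rw [← Real.exp_add, Real.exp_le_exp]
  have h2 : ((n / m * m : ℕ) : ℝ) + ((n % m : ℕ) : ℝ) = n := by exact_mod_cast Nat.div_add_mod' n m
  have h3 : ((n % m : ℕ) : ℝ) ≤ m := by exact_mod_cast (Nat.mod_lt n (by omega)).le
  have h4 : -(|c| * m) ≤ c * ((n % m : ℕ) : ℝ) := by
    have h5 : |c * ((n % m : ℕ) : ℝ)| ≤ |c| * m := by
      rw [abs_mul, Nat.abs_cast]; exact mul_le_mul_of_nonneg_left h3 (abs_nonneg c)
    exact (abs_le.1 h5).1
  rw [← h2]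
  linarith

theorem limsup_log_integral_opV_le (μ : Measure S) [IsProbabilityMeasure μ] (x₁ : S) {m : ℕ}
    (hm : 1 ≤ m) :
    limsup (fun n : ℕ => ENNReal.log (ENNReal.ofReal
        (∫ x₂, 2 * ((opV ℝ P hP m)^[n] (one ℝ (S × S)) (x₁, x₂)) ∂μ))
        / ((n * m : ℕ) : EReal)) atTop
      ≤ ENNReal.log (spectralRadius ℂ (opV ℂ P hP m)) / (m : EReal) := by
  refine EReal.le_of_forall_lt_iff_le.1 fun c hc => ?_
  have hm0 : (0 : EReal) < (m : EReal) := by exact_mod_cast hm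
  have hr : spectralRadius ℂ (opV ℂ P hP m) < ENNReal.ofReal (Real.exp (c * m)) := by
    rw [← ENNReal.log_lt_log_iff, ENNReal.log_ofReal_of_pos (Real.exp_pos _), Real.log_exp,
      EReal.coe_mul]
    exact (EReal.div_lt_iff hm0 (EReal.natCast_ne_top m)).1 hc
  refine limsup_log_div_le_of_eventually_le (d := fun n => n * m)
    (tendsto_atTop_mono (fun n => Nat.le_mul_of_pos_right n hm) tendsto_id) zero_lt_two ?_
  filter_upwards [norm_iterate_le_of_spectralRadius_lt (Real.exp_pos _) hr (one ℂ (S × S))]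
    with n hn
  refine ENNReal.ofReal_le_ofReal ((integral_opV_iterate_one_le P m hP μ x₁ n).trans ?_)
  refine mul_le_mul_of_nonneg_left (hn.trans ?_) zero_le_two
  refine (mul_le_of_le_one_right (by positivity) norm_one_le).trans (le_of_eq ?_)
  rw [← Real.exp_nat_mul]
  congr 1
  push_cast
  ring

theorem eventually_spectralRadius_opVhat_le [MeasurableEq S] {r : ℝ} (hr : 0 < r)
    (h : ∀ ε : ℝ, 0 < ε → ∃ C : ℝ, 0 < C ∧ ∃ m₀ : ℕ, ∀ m ≥ m₀,
      ⨆ (x : S) (x' : S), tvNorm ((P ^ m) x) ((P ^ m) x') ≤ ENNReal.ofReal (C * (r + ε) ^ m))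
    {ε : ℝ} (hε : 0 < ε) :
    ∃ m₁ : ℕ, ∀ m ≥ m₁,
      spectralRadius ℂ (opVhat ℂ P hP m) ≤ ENNReal.ofReal ((r + ε) ^ m) ∧
      spectralRadius ℂ (opVhat ℂ P hP m) ≤ ENNReal.ofReal (r + ε) := by
  -- Half of `ε` is kept in reserve: the ratio `q < 1` makes `C * q ^ m` eventually at most 1 and so
  -- absorbs `C`.
  obtain ⟨C, hC, m₀, hm₀⟩ := h (ε / 2) (half_pos hε)
  set q := (r + ε / 2) / (r + ε) with hq
  have hrε : 0 < r + ε := by linarith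
  have hq0 : 0 ≤ q := by positivity
  have hq1 : q < 1 := by rw [hq, div_lt_one hrε]; linarith
  have hlim : Tendsto (fun m => C * q ^ m) atTop (𝓝 0) := by
    simpa using (tendsto_pow_atTop_nhds_zero_of_lt_one hq0 hq1).const_mul C
  obtain ⟨m₂, hm₂⟩ := eventually_atTop.1 (hlim.eventually_le_const zero_lt_one)
  refine ⟨max m₀ (max m₂ 1), fun m hm => ?_⟩
  have hm0 : m₀ ≤ m := (le_max_left _ _).trans hm
  have hm2 : m₂ ≤ m := (le_max_left _ _).trans ((le_max_right _ _).trans hm)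
  have hm1 : m ≠ 0 := Nat.one_le_iff_ne_zero.1
    ((le_max_right _ _).trans ((le_max_right _ _).trans hm))
  have hle : C * (r + ε / 2) ^ m ≤ (r + ε) ^ m := by
    have h1 : (r + ε / 2) ^ m = q ^ m * (r + ε) ^ m := by
      rw [← mul_pow, hq, div_mul_cancel₀ _ hrε.ne']
    rw [h1, ← mul_assoc]
    exact mul_le_of_le_one_left (by positivity) (hm₂ m hm2)
  have hpow : spectralRadius ℂ (opVhat ℂ P hP m) ≤ ENNReal.ofReal ((r + ε) ^ m) :=
    spectralRadius_opVhat_le P hP m (by positivity) fun x x' =>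
      (one_sub_overlap_le_tvNorm P m x x').trans <|
        (le_iSup₂ (f := fun x x' => tvNorm ((P ^ m) x) ((P ^ m) x')) x x').trans <|
          (hm₀ m hm0).trans (ENNReal.ofReal_le_ofReal hle)
  refine ⟨hpow, ?_⟩
  -- Below 1 the `m`-th power is the smaller bound; above 1 the trivial bound `1 - α ≤ 1` suffices.
  rcases le_total (r + ε) 1 with h1 | h1
  · exact hpow.trans (ENNReal.ofReal_le_ofReal (pow_le_of_le_one hrε.le h1 hm1))
  · exact spectralRadius_opVhat_le P hP m hrε.le fun x x' =>
      tsub_le_self.trans (by simpa using ENNReal.ofReal_le_ofReal h1)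

theorem opV_pow_apply (m n : ℕ) (f : BoundedMeasurable ℝ (S × S)) :
    ((opV ℝ P hP m) ^ n) f = (opV ℝ P hP m)^[n] f :=
  congrFun (FunLike.coe_pow_eq_iterate (opV ℝ P hP m) n) f

end Main

theorem mainTheorem2 {S : Type*} [MeasurableSpace S] [MeasurableEq S]
    (P : Kernel S S) [IsMarkovKernel P] (hP : MeasurableCoupling P) :
    (∀ (μ : Measure S) [IsProbabilityMeasure μ], P.Invariant μ → ∀ (x₁ : S) (m : ℕ), 1 ≤ m →
      limsup (fun n : ℕ => ENNReal.log (tvNorm ((P ^ n) x₁) μ) / (n : EReal)) atTop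
        ≤ limsup (fun n : ℕ => ENNReal.log (ENNReal.ofReal
            (∫ x₂, 2 * ((opV ℝ P hP m) ^ n) (BoundedMeasurable.one ℝ (S × S)) (x₁, x₂) ∂μ))
            / ((n * m : ℕ) : EReal)) atTop ∧
      limsup (fun n : ℕ => ENNReal.log (ENNReal.ofReal
          (∫ x₂, 2 * ((opV ℝ P hP m) ^ n) (BoundedMeasurable.one ℝ (S × S)) (x₁, x₂) ∂μ))
          / ((n * m : ℕ) : EReal)) atTop
        ≤ ENNReal.log (spectralRadius ℂ (opV ℂ P hP m)) / (m : EReal) ∧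
      ENNReal.log (spectralRadius ℂ (opV ℂ P hP m)) / (m : EReal)
        = ENNReal.log (spectralRadius ℂ (opVhat ℂ P hP m)) / (m : EReal)) ∧
    (∀ r : ℝ, 0 < r →
      (∀ ε : ℝ, 0 < ε → ∃ C : ℝ, 0 < C ∧ ∃ m₀ : ℕ, ∀ m ≥ m₀,
        ⨆ (x : S) (x' : S), tvNorm ((P ^ m) x) ((P ^ m) x')
          ≤ ENNReal.ofReal (C * (r + ε) ^ m)) →
      ∀ ε : ℝ, 0 < ε → ∃ m₁ : ℕ, ∀ m ≥ m₁,
        spectralRadius ℂ (opVhat ℂ P hP m) ≤ ENNReal.ofReal ((r + ε) ^ m) ∧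
        spectralRadius ℂ (opVhat ℂ P hP m) ≤ ENNReal.ofReal (r + ε)) := by
  refine ⟨fun μ _ hμ x₁ m hm => ?_, fun r hr h ε hε =>
    eventually_spectralRadius_opVhat_le P hP hr h hε⟩
  simp only [opV_pow_apply]
  exact ⟨limsup_log_tvNorm_le P hP hμ x₁ hm, limsup_log_integral_opV_le P hP μ x₁ hm,
    by rw [spectralRadius_opV_eq]⟩
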